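/- Let $\mathcal{B}$ be a complete Boolean algebra and let $Q$ be its Stone space (a compact, extremally disconnected Hausdorff space). Let $C(Q)$ be the algebra of continuous functions $Q\to\mathbb{R}$, and let $L^0(\mathcal{B})=C_\infty(Q)$ be the set of continuous functions $x\colon Q\to[-\infty,+\infty]$ that take the values $\pm\infty$ at most on a nowhere dense set. With the pointwise order, and with the algebraic operations that extend by continuity the pointwise ones from the dense open sets where all the functions involved are finite, $L^0(\mathcal{B})$ is a real commutative algebra and a vector lattice containing $C(Q)$. An element $e\in\mathcal{B}$ is identified with the characteristic function of the corresponding clopen subset of $Q$; the elements of $\mathcal{B}$ are in this way exactly the idempotents of $L^0(\mathcal{B})$, and $\mathbf{1}$ is the constant function one. Theorem. Let $\delta\colon C(Q)\to L^0(\mathcal{B})$ be a non-zero derivation, that is, an $\mathbb{R}$-linear map, not identically zero, such that $\delta(xy)=\delta(x)y+x\delta(y)$ for all $x,y\in C(Q)$. Then there exist a sequence $(a_n)_{n\in\mathbb{N}}$ in $C(Q)$ and a non-zero idempotent $q\in\mathcal{B}$ such that $|a_n|\leqslant\mathbf{1}$ and $|\delta(a_n)|\geqslant nq$ for all $n\in\mathbb{N}$.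 -/

import Mathlib

open Set Topology TopologicalSpace

universe u

/-! ### The Stone space of a Boolean algebra -/

/-- The Stone space of a Boolean algebra `B`: its points are the ultrafilters of `B`, given as the
Boolean homomorphisms from `B` to the two-element algebra. -/
def StoneSpace (B : Type u) [BooleanAlgebra B] : Type u := BoundedLatticeHom B Bool

namespace StoneSpace

section Boolean

variable {B : Type u} [BooleanAlgebra B]

/-- The value of the point `t` (a homomorphism to `Bool`) at the element `e`. -/
noncomputable def eval (t : StoneSpace B) (e : B) : Bool := BoundedLatticeHom.toLatticeHom t e

/-- The Stone topology is the topology of pointwise convergence; a base of it is formed by the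
sets `{t | t.eval e = true}`. -/
noncomputable instance : TopologicalSpace (StoneSpace B) :=
  TopologicalSpace.induced (fun (t : StoneSpace B) (e : B) => t.eval e) inferInstance

/-- The set `Q(e)` of the ultrafilters that contain `e`. -/
def basic (e : B) : Set (StoneSpace B) := {t | t.eval e = true}

theorem eval_bot (t : StoneSpace B) : t.eval ⊥ = false := BoundedLatticeHom.map_bot' t

theorem eval_top (t : StoneSpace B) : t.eval ⊤ = true := BoundedLatticeHom.map_top' t

theorem eval_inf (t : StoneSpace B) (a b : B) : t.eval (a ⊓ b) = (t.eval a && t.eval b) :=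
  map_inf (BoundedLatticeHom.toLatticeHom t) a b

theorem eval_sup (t : StoneSpace B) (a b : B) : t.eval (a ⊔ b) = (t.eval a || t.eval b) :=
  map_sup (BoundedLatticeHom.toLatticeHom t) a b

theorem eval_compl (t : StoneSpace B) (a : B) : t.eval aᶜ = !(t.eval a) := by
  have h1 := t.eval_inf a aᶜ
  have h2 := t.eval_sup a aᶜ
  rw [inf_compl_eq_bot, eval_bot] at h1
  rw [sup_compl_eq_top, eval_top] at h2
  revert h1 h2
  cases t.eval a <;> cases t.eval aᶜ <;> simp

theorem eval_mono (t : StoneSpace B) {a b : B} (h : a ≤ b) (ha : t.eval a = true) :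
    t.eval b = true := by
  have h1 := t.eval_inf a b
  rw [inf_eq_left.2 h, ha] at h1
  simpa using h1.symm

theorem eval_injective :
    Function.Injective (fun (t : StoneSpace B) (e : B) => t.eval e) := by
  intro s t h
  exact DFunLike.ext (F := BoundedLatticeHom B Bool) s t (fun e => congrFun h e)

theorem isEmbedding_eval : IsEmbedding (fun (t : StoneSpace B) (e : B) => t.eval e) :=
  ⟨⟨rfl⟩, eval_injective⟩

theorem continuous_eval (e : B) : Continuous (fun t : StoneSpace B => t.eval e) :=
  (continuous_apply e).comp isEmbedding_eval.continuous

theorem isClopen_basic (e : B) : IsClopen (basic e) :=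
  (isClopen_discrete ({true} : Set Bool)).preimage (continuous_eval e)

instance : T2Space (StoneSpace B) := isEmbedding_eval.t2Space

theorem isClosed_range_eval :
    IsClosed (range (fun (t : StoneSpace B) (e : B) => t.eval e)) := by
  have : range (fun (t : StoneSpace B) (e : B) => t.eval e)
      = {f : B → Bool | f ⊥ = false} ∩ {f | f ⊤ = true}
        ∩ (⋂ a, ⋂ b, {f | f (a ⊓ b) = (f a && f b)})
        ∩ (⋂ a, ⋂ b, {f | f (a ⊔ b) = (f a || f b)}) := by
    ext f
    constructor
    · rintro ⟨t, rfl⟩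
      simp only [mem_inter_iff, mem_ofPred_eq, mem_iInter]
      exact ⟨⟨⟨t.eval_bot, t.eval_top⟩, t.eval_inf⟩, t.eval_sup⟩
    · simp only [mem_inter_iff, mem_ofPred_eq, mem_iInter]
      rintro ⟨⟨⟨h0, h1⟩, h2⟩, h3⟩
      exact ⟨(⟨⟨⟨f, h3⟩, h2⟩, h1, h0⟩ : BoundedLatticeHom B Bool), rfl⟩
  rw [this]
  have c2 : Continuous (fun p : Bool × Bool => (p.1 && p.2)) := continuous_of_discreteTopology
  have c3 : Continuous (fun p : Bool × Bool => (p.1 || p.2)) := continuous_of_discreteTopology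
  refine IsClosed.inter (IsClosed.inter (IsClosed.inter ?_ ?_) ?_) ?_
  · exact isClosed_eq (continuous_apply _) continuous_const
  · exact isClosed_eq (continuous_apply _) continuous_const
  · exact isClosed_iInter fun a => isClosed_iInter fun b => isClosed_eq (continuous_apply _)
      (c2.comp₂ (continuous_apply a) (continuous_apply b))
  · exact isClosed_iInter fun a => isClosed_iInter fun b => isClosed_eq (continuous_apply _)
      (c3.comp₂ (continuous_apply a) (continuous_apply b))

instance : CompactSpace (StoneSpace B) :=
  IsClosedEmbedding.compactSpace ⟨isEmbedding_eval, isClosed_range_eval⟩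

/-- The sets `Q(e)` form a base of the topology. -/
theorem exists_basic_subset {U : Set (StoneSpace B)} (hU : IsOpen U) {t : StoneSpace B}
    (ht : t ∈ U) : ∃ e : B, t ∈ basic e ∧ basic e ⊆ U := by
  obtain ⟨V, hV, rfl⟩ := isOpen_induced_iff.1 hU
  obtain ⟨I, v, hv, hIV⟩ := isOpen_pi_iff.1 hV _ ht
  classical
  refine ⟨I.inf (fun a => if t.eval a = true then a else aᶜ), ?_, ?_⟩
  · show t.eval _ = true
    clear hIV hv
    induction I using Finset.induction_on with
    | empty => simpa using t.eval_top
    | insert a s _ ih =>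
      rw [Finset.inf_insert, eval_inf, ih, Bool.and_true]
      split_ifs with h
      · exact h
      · rw [eval_compl]; simpa using h
  · intro s hs
    apply hIV
    intro a ha
    have h1 : s.eval (if t.eval a = true then a else aᶜ) = true :=
      s.eval_mono (Finset.inf_le (f := fun a => if t.eval a = true then a else aᶜ) ha) hs
    have h2 : s.eval a = t.eval a := by
      split_ifs at h1 with h
      · rw [h1, h]
      · rw [eval_compl] at h1
        revert h h1
        cases s.eval a <;> cases t.eval a <;> simp
    show s.eval a ∈ v a
    rw [h2]
    exact (hv a ha).2

/-- Every non-zero element belongs to an ultrafilter. -/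
theorem basic_nonempty {e : B} (he : e ≠ ⊥) : (basic e).Nonempty := by
  have hd : Disjoint ((Order.PFilter.principal e : Order.PFilter B) : Set B)
      ((Order.Ideal.principal ⊥ : Order.Ideal B) : Set B) := by
    rw [Set.disjoint_left]
    intro x hx hx'
    have h1 : e ≤ x := Order.PFilter.mem_principal.1 hx
    have h2 : x ≤ ⊥ := Order.Ideal.mem_principal.1 hx'
    exact he (le_bot_iff.1 (h1.trans h2))
  obtain ⟨J, hJ, -, hd⟩ := DistribLattice.prime_ideal_of_disjoint_filter_ideal hd
  classical
  have heJ : e ∉ J := fun h =>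
    Set.disjoint_left.1 hd (Order.PFilter.mem_principal.2 le_rfl) h
  have htop : (⊤ : B) ∉ J := fun h => heJ (J.lower le_top h)
  refine ⟨(⟨⟨⟨fun x => decide (x ∉ J), fun a b => ?_⟩, fun a b => ?_⟩, ?_, ?_⟩ :
    BoundedLatticeHom B Bool), ?_⟩
  · have : a ⊔ b ∈ J ↔ a ∈ J ∧ b ∈ J := Order.Ideal.sup_mem_iff
    by_cases ha : a ∈ J <;> by_cases hb : b ∈ J <;> simp [this, ha, hb]
  · have : a ⊓ b ∈ J ↔ a ∈ J ∨ b ∈ J :=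
      ⟨fun h => hJ.mem_or_mem h, fun h => h.elim (J.lower inf_le_left) (J.lower inf_le_right)⟩
    by_cases ha : a ∈ J <;> by_cases hb : b ∈ J <;> simp [this, ha, hb]
  · simpa using htop
  · simp
  · show decide (e ∉ J) = true
    simpa using heJ

end Boolean

/-- The Stone space of a complete Boolean algebra is extremally disconnected. -/
instance {B : Type u} [CompleteBooleanAlgebra B] : ExtremallyDisconnected (StoneSpace B) where
  open_closure U hU := by
    have key : closure U = basic (sSup {e : B | basic e ⊆ U}) := by
      apply Subset.antisymm
      · refine closure_minimal (fun t ht => ?_) (isClopen_basic _).isClosed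
        obtain ⟨e, hte, heU⟩ := exists_basic_subset hU ht
        exact t.eval_mono (le_sSup heU) hte
      · intro t ht
        rw [mem_closure_iff]
        intro V hV htV
        obtain ⟨f, htf, hfV⟩ := exists_basic_subset hV htV
        have hne : f ⊓ sSup {e : B | basic e ⊆ U} ≠ ⊥ := by
          intro h0
          have h1 := t.eval_inf f (sSup {e : B | basic e ⊆ U})
          rw [h0, eval_bot] at h1
          rw [show t.eval f = true from htf,
            show t.eval (sSup {e : B | basic e ⊆ U}) = true from ht] at h1
          simp at h1
        have : ∃ e : B, basic e ⊆ U ∧ f ⊓ e ≠ ⊥ := by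
          by_contra! hcon
          apply hne
          rw [inf_sSup_eq]
          simpa using hcon
        obtain ⟨e, heU, hfe⟩ := this
        obtain ⟨s, hs⟩ := basic_nonempty hfe
        exact ⟨s, hfV (s.eval_mono inf_le_left hs), heU (s.eval_mono inf_le_right hs)⟩
    rw [key]
    exact (isClopen_basic _).isOpen

end StoneSpace

/-! ### The algebra of extended continuous functions -/

/-- `CInfty Q`: the continuous functions `Q → [-∞, +∞]` that take the values `±∞` at most on a
nowhere dense set. -/
structure CInfty (Q : Type u) [TopologicalSpace Q] where
  toFun : Q → EReal
  continuous_toFun : Continuous toFun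
  isNowhereDense_infinite : IsNowhereDense {t | toFun t = ⊤ ∨ toFun t = ⊥}

namespace CInfty

noncomputable section

section Basic

theorem infinite_eq_compl {Q : Type u} (f : Q → EReal) :
    {t | f t = ⊤ ∨ f t = ⊥} = {t | ∃ r : ℝ, f t = (r : EReal)}ᶜ := by
  ext t
  simp only [mem_ofPred_eq, mem_compl_iff]
  induction f t <;> simp

variable {Q : Type u} [TopologicalSpace Q]

instance : CoeFun (CInfty Q) (fun _ => Q → EReal) := ⟨toFun⟩

theorem coe_injective : Function.Injective (fun (x : CInfty Q) => (x : Q → EReal)) := by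
  rintro ⟨f, _, _⟩ ⟨g, _, _⟩ h
  cases h
  rfl

/-- The set of the points at which `x` is finite. -/
def finiteSet (x : CInfty Q) : Set Q := {t | ∃ r : ℝ, x t = (r : EReal)}

theorem isOpen_finite_of_continuous {f : Q → EReal} (hf : Continuous f) :
    IsOpen {t | ∃ r : ℝ, f t = (r : EReal)} := by
  rw [← isClosed_compl_iff, ← infinite_eq_compl]
  exact (isClosed_eq hf continuous_const).union (isClosed_eq hf continuous_const)

theorem isOpen_finiteSet (x : CInfty Q) : IsOpen x.finiteSet :=
  isOpen_finite_of_continuous x.continuous_toFun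

theorem dense_finiteSet (x : CInfty Q) : Dense x.finiteSet := by
  have h := x.isNowhereDense_infinite
  rw [infinite_eq_compl,
    (isOpen_finite_of_continuous x.continuous_toFun).isClosed_compl.isNowhereDense_iff,
    interior_eq_empty_iff_dense_compl, compl_compl] at h
  exact h

/-- A continuous function that is finite on a dense set belongs to `CInfty Q`. -/
def ofDense (f : Q → EReal) (hf : Continuous f) (h : Dense {t | ∃ r : ℝ, f t = (r : EReal)}) :
    CInfty Q where
  toFun := f
  continuous_toFun := hf
  isNowhereDense_infinite := by
    rw [infinite_eq_compl, (isOpen_finite_of_continuous hf).isClosed_compl.isNowhereDense_iff,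
      interior_eq_empty_iff_dense_compl, compl_compl]
    exact h

/-- Elements of `CInfty Q` that agree on a dense set are equal. -/
theorem ext_of_dense {x y : CInfty Q} {U : Set Q} (hU : Dense U) (h : ∀ t ∈ U, x t = y t) :
    x = y :=
  coe_injective (Continuous.ext_on hU x.continuous_toFun y.continuous_toFun h)

theorem dense_inter (x y : CInfty Q) : Dense (x.finiteSet ∩ y.finiteSet) :=
  x.dense_finiteSet.inter_of_isOpen_left y.dense_finiteSet x.isOpen_finiteSet

/-- Constants, more generally real continuous functions, as elements of `CInfty Q`. -/
def ofC (a : C(Q, ℝ)) : CInfty Q :=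
  ofDense (fun t => ((a t : ℝ) : EReal)) (continuous_coe_real_ereal.comp a.continuous)
    (by
      have : {t | ∃ r : ℝ, ((a t : ℝ) : EReal) = (r : EReal)} = univ :=
        eq_univ_of_forall fun t => ⟨a t, rfl⟩
      rw [this]
      exact dense_univ)

theorem ofC_apply (a : C(Q, ℝ)) (t : Q) : ofC a t = ((a t : ℝ) : EReal) := rfl

/-- The order of `CInfty Q` is the pointwise one. -/
instance : PartialOrder (CInfty Q) :=
  PartialOrder.lift (fun x => (x : Q → EReal)) coe_injective

theorem le_def (x y : CInfty Q) : x ≤ y ↔ ∀ t, x t ≤ y t := Iff.rfl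

/-- The lattice operations of `CInfty Q` are the pointwise ones. -/
instance : Lattice (CInfty Q) where
  sup x y := ofDense (fun t => max (x t) (y t)) (x.continuous_toFun.max y.continuous_toFun)
    ((dense_inter x y).mono (by
      rintro t ⟨⟨r, hr⟩, ⟨s, hs⟩⟩
      exact ⟨max r s, by rw [hr, hs]; exact (EReal.coe_strictMono.monotone.map_max).symm⟩))
  le_sup_left _ _ _ := le_max_left _ _
  le_sup_right _ _ _ := le_max_right _ _
  sup_le _ _ _ h1 h2 t := max_le (h1 t) (h2 t)
  inf x y := ofDense (fun t => min (x t) (y t)) (x.continuous_toFun.min y.continuous_toFun)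
    ((dense_inter x y).mono (by
      rintro t ⟨⟨r, hr⟩, ⟨s, hs⟩⟩
      exact ⟨min r s, by rw [hr, hs]; exact (EReal.coe_strictMono.monotone.map_min).symm⟩))
  inf_le_left _ _ _ := min_le_left _ _
  inf_le_right _ _ _ := min_le_right _ _
  le_inf _ _ _ h1 h2 t := le_min (h1 t) (h2 t)

theorem continuousOn_toReal (x : CInfty Q) :
    ContinuousOn (fun t => (x t).toReal) x.finiteSet := by
  refine EReal.continuousOn_toReal.comp x.continuous_toFun.continuousOn ?_
  rintro t ⟨r, hr⟩
  simp [hr]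

instance : Neg (CInfty Q) := ⟨fun x => ofDense (fun t => -x t)
  (continuous_neg.comp x.continuous_toFun)
  (x.dense_finiteSet.mono (by
    rintro t ⟨r, hr⟩
    exact ⟨-r, by rw [hr]; rfl⟩))⟩

instance : Zero (CInfty Q) := ⟨ofC 0⟩

instance : One (CInfty Q) := ⟨ofC 1⟩

theorem neg_apply (x : CInfty Q) (t : Q) : (-x) t = -x t := rfl

theorem zero_apply (t : Q) : (0 : CInfty Q) t = ((0 : ℝ) : EReal) := rfl

theorem one_apply (t : Q) : (1 : CInfty Q) t = ((1 : ℝ) : EReal) := rfl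

theorem ext₁ (x : CInfty Q) {a b : CInfty Q}
    (h : ∀ t, ∀ r : ℝ, x t = r → a t = b t) : a = b :=
  ext_of_dense x.dense_finiteSet fun t ⟨r, hr⟩ => h t r hr

theorem ext₂ (x y : CInfty Q) {a b : CInfty Q}
    (h : ∀ t, ∀ r s : ℝ, x t = r → y t = s → a t = b t) : a = b :=
  ext_of_dense (dense_inter x y) fun t ⟨⟨r, hr⟩, ⟨s, hs⟩⟩ => h t r s hr hs

theorem ext₃ (x y z : CInfty Q) {a b : CInfty Q}
    (h : ∀ t, ∀ r s u : ℝ, x t = r → y t = s → z t = u → a t = b t) : a = b :=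
  ext_of_dense ((dense_inter x y).inter_of_isOpen_left z.dense_finiteSet
    (x.isOpen_finiteSet.inter y.isOpen_finiteSet))
    fun t ⟨⟨⟨r, hr⟩, ⟨s, hs⟩⟩, ⟨u, hu⟩⟩ => h t r s u hr hs hu

end Basic

variable {Q : Type u} [TopologicalSpace Q] [CompactSpace Q] [T2Space Q] [ExtremallyDisconnected Q]

/-- In an extremally disconnected compact space, a real function that is continuous on a dense open
set extends from that set to an element of `CInfty Q`. -/
theorem exists_extension {U : Set Q} (hU : IsOpen U) (hUd : Dense U) {f : Q → ℝ}
    (hf : ContinuousOn f U) : ∃ x : CInfty Q, ∀ t ∈ U, x t = (f t : EReal) := by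
  let F : Q → EReal := fun t => (f t : EReal)
  have hF : ContinuousOn F U := continuous_coe_real_ereal.comp_continuousOn hf
  let G : Set (Q × EReal) := closure ((fun t => (t, F t)) '' U)
  have hGc : CompactSpace G := isCompact_iff_compactSpace.1 isClosed_closure.isCompact
  let π : G → Q := fun p => p.1.1
  have hπ : Continuous π := continuous_fst.comp continuous_subtype_val
  have hs : Function.Surjective π := by
    have h1 : IsClosed (range π) := (isCompact_range hπ).isClosed
    have h2 : U ⊆ range π := fun t ht => ⟨⟨(t, F t), subset_closure ⟨t, ht, rfl⟩⟩, rfl⟩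
    have h3 : range π = univ := (hUd.mono h2).closure_eq ▸ h1.closure_eq.symm
    exact range_eq_univ.1 h3
  obtain ⟨h, hc, hh⟩ := CompactT2.ExtremallyDisconnected.projective (A := Q)
    (continuous_id (X := Q)) hπ hs
  have hval : ∀ t ∈ U, (h t).1.2 = F t := by
    intro t ht
    have hfst : (h t).1.1 = t := congrFun hh t
    have hFt : Filter.Tendsto F (𝓝 t) (𝓝 (F t)) := hF.continuousAt (hU.mem_nhds ht)
    by_contra hne
    obtain ⟨V, W, hV, hW, hV1, hW1, hVW⟩ := t2_separation hne
    have hN : F ⁻¹' W ∈ 𝓝 t := hFt (hW.mem_nhds hW1)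
    obtain ⟨N, hNW, hNo, htN⟩ := mem_nhds_iff.1 hN
    obtain ⟨p, ⟨hp1, hp2⟩, s, -, rfl⟩ := mem_closure_iff.1 (h t).2 (N ×ˢ V) (hNo.prod hV)
      ⟨by rw [hfst]; exact htN, hV1⟩
    exact Set.disjoint_left.1 hVW hp2 (hNW hp1)
  refine ⟨ofDense (fun t => (h t).1.2)
    (continuous_snd.comp (continuous_subtype_val.comp hc))
    (hUd.mono fun t ht => ⟨f t, hval t ht⟩), hval⟩

theorem exists_add (x y : CInfty Q) : ∃ z : CInfty Q, ∀ t ∈ x.finiteSet ∩ y.finiteSet,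
    z t = (((x t).toReal + (y t).toReal : ℝ) : EReal) :=
  exists_extension (x.isOpen_finiteSet.inter y.isOpen_finiteSet) (dense_inter x y)
    ((x.continuousOn_toReal.mono inter_subset_left).add
      (y.continuousOn_toReal.mono inter_subset_right))

theorem exists_mul (x y : CInfty Q) : ∃ z : CInfty Q, ∀ t ∈ x.finiteSet ∩ y.finiteSet,
    z t = (((x t).toReal * (y t).toReal : ℝ) : EReal) :=
  exists_extension (x.isOpen_finiteSet.inter y.isOpen_finiteSet) (dense_inter x y)
    ((x.continuousOn_toReal.mono inter_subset_left).mul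
      (y.continuousOn_toReal.mono inter_subset_right))

/-- The sum is the unique element of `CInfty Q` that is equal to the pointwise sum wherever both
summands are finite. -/
instance : Add (CInfty Q) := ⟨fun x y => (exists_add x y).choose⟩

/-- The product is the unique element of `CInfty Q` that is equal to the pointwise product wherever
both factors are finite. -/
instance : Mul (CInfty Q) := ⟨fun x y => (exists_mul x y).choose⟩

theorem add_apply {x y : CInfty Q} {t : Q} {r s : ℝ} (hx : x t = r) (hy : y t = s) :
    (x + y) t = ((r + s : ℝ) : EReal) := by
  have h := (exists_add x y).choose_spec t ⟨⟨r, hx⟩, ⟨s, hy⟩⟩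
  rw [hx, hy] at h
  exact h

theorem mul_apply {x y : CInfty Q} {t : Q} {r s : ℝ} (hx : x t = r) (hy : y t = s) :
    (x * y) t = ((r * s : ℝ) : EReal) := by
  have h := (exists_mul x y).choose_spec t ⟨⟨r, hx⟩, ⟨s, hy⟩⟩
  rw [hx, hy] at h
  exact h

instance : CommRing (CInfty Q) where
  add_assoc x y z := ext₃ x y z fun t r s u hx hy hz => by
    rw [add_apply (add_apply hx hy) hz, add_apply hx (add_apply hy hz), add_assoc]
  zero_add x := ext₁ x fun t r hx => by rw [add_apply (zero_apply t) hx, zero_add, hx]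
  add_zero x := ext₁ x fun t r hx => by rw [add_apply hx (zero_apply t), add_zero, hx]
  add_comm x y := ext₂ x y fun t r s hx hy => by
    rw [add_apply hx hy, add_apply hy hx, add_comm]
  neg_add_cancel x := ext₁ x fun t r hx => by
    have h : (-x) t = ((-r : ℝ) : EReal) := by rw [neg_apply, hx]; rfl
    rw [add_apply h hx, neg_add_cancel, zero_apply]
  mul_assoc x y z := ext₃ x y z fun t r s u hx hy hz => by
    rw [mul_apply (mul_apply hx hy) hz, mul_apply hx (mul_apply hy hz), mul_assoc]
  one_mul x := ext₁ x fun t r hx => by rw [mul_apply (one_apply t) hx, one_mul, hx]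
  mul_one x := ext₁ x fun t r hx => by rw [mul_apply hx (one_apply t), mul_one, hx]
  mul_comm x y := ext₂ x y fun t r s hx hy => by
    rw [mul_apply hx hy, mul_apply hy hx, mul_comm]
  zero_mul x := ext₁ x fun t r hx => by
    rw [mul_apply (zero_apply t) hx, zero_mul, zero_apply]
  mul_zero x := ext₁ x fun t r hx => by
    rw [mul_apply hx (zero_apply t), mul_zero, zero_apply]
  left_distrib x y z := ext₃ x y z fun t r s u hx hy hz => by
    rw [mul_apply hx (add_apply hy hz), add_apply (mul_apply hx hy) (mul_apply hx hz), mul_add]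
  right_distrib x y z := ext₃ x y z fun t r s u hx hy hz => by
    rw [mul_apply (add_apply hx hy) hz, add_apply (mul_apply hx hz) (mul_apply hy hz), add_mul]
  nsmul := nsmulRec
  zsmul := zsmulRec

/-- The inclusion of the algebra `C(Q)` into `CInfty Q`. -/
def ofCHom : C(Q, ℝ) →+* CInfty Q where
  toFun := ofC
  map_zero' := rfl
  map_one' := rfl
  map_add' a b := coe_injective (funext fun t =>
    (add_apply (ofC_apply a t) (ofC_apply b t)).symm)
  map_mul' a b := coe_injective (funext fun t =>
    (mul_apply (ofC_apply a t) (ofC_apply b t)).symm)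

/-- `CInfty Q` is an algebra over its subalgebra `C(Q)`. -/
instance : Algebra C(Q, ℝ) (CInfty Q) := ofCHom.toAlgebra

/-- `CInfty Q` is an algebra over `ℝ`, the real numbers being the constant functions. -/
instance : Algebra ℝ (CInfty Q) := (ofCHom.comp (algebraMap ℝ C(Q, ℝ))).toAlgebra

instance : IsScalarTower ℝ C(Q, ℝ) (CInfty Q) := IsScalarTower.of_algebraMap_eq' rfl

end

end CInfty

/-- `L0 B` is `C_∞(Q)` for the Stone space `Q` of the complete Boolean algebra `B`. -/
abbrev L0 (B : Type u) [CompleteBooleanAlgebra B] : Type u := CInfty (StoneSpace B)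

open Classical in
/-- The element `e` of `B` as an idempotent of `L0 B`: the characteristic function of `Q(e)`. -/
noncomputable def L0.idem {B : Type u} [CompleteBooleanAlgebra B] (e : B) : L0 B :=
  CInfty.ofC ⟨fun t => if t ∈ StoneSpace.basic e then 1 else 0,
    continuous_const.if (fun _ ht => absurd ht (by
      show _ ∉ frontier (StoneSpace.basic e)
      rw [(StoneSpace.isClopen_basic e).frontier_eq]; exact notMem_empty _)) continuous_const⟩

/-!
A derivation kills every idempotent, hence every step function, so by the Stone-Weierstrass theorem
its kernel is dense in `C(Q)`. Changing `x` by a kernel element close to it does not change `δ x`;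
thus `δ` takes all of its values already on the unit ball. If `|δ x| ≥ c e` for some `c > 0` and
some idempotent `e ≠ 0`, the value `δ ((n / c) x)`, which dominates `n e` in absolute value, is
therefore the value at some `a n` with `‖a n‖ ≤ 1`.
-/

section Derivation

theorem derivation_apply_eq_zero_of_isIdempotentElem {R A M : Type*} [CommSemiring R]
    [CommSemiring A] [Algebra R A] [AddCommGroup M] [Module R M] [Module A M]
    (D : Derivation R A M) {e : A} (he : IsIdempotentElem e) : D e = 0 := by
  have h_leibniz : D e = e • D e + e • D e := by rw [← D.leibniz, he.eq]
  have h_smul : e • D e = e • D e + e • D e := by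
    nth_rw 1 [h_leibniz]
    rw [smul_add, smul_smul, he.eq]
  rw [h_leibniz, left_eq_add.1 h_smul, add_zero]

variable {X : Type*} [TopologicalSpace X]

theorem isIdempotentElem_charFn {U : Set X} (hU : IsClopen U) :
    IsIdempotentElem (LocallyConstant.charFn ℝ hU : C(X, ℝ)) := by
  ext t
  by_cases ht : t ∈ U <;> simp [LocallyConstant.coe_charFn, ht]

theorem separatesPoints_adjoin_isIdempotentElem [TotallySeparatedSpace X] :
    (Algebra.adjoin ℝ {e : C(X, ℝ) | IsIdempotentElem e}).SeparatesPoints := by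
  intro s t hst
  obtain ⟨U, hU, hs, ht⟩ := exists_isClopen_of_totally_separated hst
  refine ⟨_, ⟨_, Algebra.subset_adjoin (isIdempotentElem_charFn hU), rfl⟩, ?_⟩
  simp_all [LocallyConstant.coe_charFn]

theorem dense_setOf_derivation_eq_zero [CompactSpace X] [TotallySeparatedSpace X] {M : Type*}
    [AddCommGroup M] [Module ℝ M] [Module C(X, ℝ) M] (D : Derivation ℝ C(X, ℝ) M) :
    Dense {f | D f = 0} := by
  have h_dense : Dense (Algebra.adjoin ℝ {e : C(X, ℝ) | IsIdempotentElem e} : Set C(X, ℝ)) :=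
    fun f => ContinuousMap.continuousMap_mem_subalgebra_closure_of_separatesPoints _
      separatesPoints_adjoin_isIdempotentElem f
  exact h_dense.mono <| Derivation.eqOn_adjoin (D2 := 0) fun _ he =>
    derivation_apply_eq_zero_of_isIdempotentElem D he

end Derivation

theorem exists_norm_lt_map_eq_of_dense {E F 𝓕 : Type*} [SeminormedAddCommGroup E] [AddGroup F]
    [FunLike 𝓕 E F] [AddMonoidHomClass 𝓕 E F] (f : 𝓕) (hf : Dense {s | f s = 0}) (x : E) {ε : ℝ}
    (hε : 0 < ε) : ∃ a, ‖a‖ < ε ∧ f a = f x := by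
  obtain ⟨s, hs, hsx⟩ := hf.exists_dist_lt x hε
  refine ⟨x - s, by rwa [← dist_eq_norm], ?_⟩
  rw [map_sub, hs, sub_zero]

theorem abs_le_one_of_norm_le_one {X : Type*} [TopologicalSpace X] [CompactSpace X] {a : C(X, ℝ)}
    (ha : ‖a‖ ≤ 1) : |a| ≤ 1 :=
  fun t => (a.norm_coe_le_norm t).trans ha

namespace CInfty

section Basic

variable {Q : Type u} [TopologicalSpace Q]

theorem le_of_dense {x y : CInfty Q} {U : Set Q} (hU : Dense U) (h : ∀ t ∈ U, x t ≤ y t) :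
    x ≤ y := fun t =>
  closure_minimal h (isClosed_le x.continuous_toFun y.continuous_toFun) (hU t)

theorem exists_coe_ne_zero {x : CInfty Q} (hx : x ≠ 0) : ∃ t, ∃ r : ℝ, x t = r ∧ r ≠ 0 := by
  by_contra! h
  exact hx (ext₁ x fun t r hr => by rw [zero_apply, hr, h t r hr])

/-- The characteristic function of a clopen set as an element of `CInfty Q`. It is the counterpart
of `L0.idem` for a space `Q` that is not given as a Stone space. -/
noncomputable def charFn (K : Clopens Q) : CInfty Q :=
  ofC (LocallyConstant.charFn ℝ K.isClopen)

theorem charFn_apply (K : Clopens Q) (t : Q) :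
    charFn K t = (((K : Set Q).indicator 1 t : ℝ) : EReal) := rfl

end Basic

variable {Q : Type u} [TopologicalSpace Q] [CompactSpace Q] [T2Space Q] [ExtremallyDisconnected Q]

theorem abs_apply (x : CInfty Q) (t : Q) : |x| t = max (x t) (-x t) := rfl

theorem abs_apply_coe {x : CInfty Q} {t : Q} {r : ℝ} (hx : x t = r) :
    |x| t = ((|r| : ℝ) : EReal) := by
  rw [abs_apply, hx]
  exact (EReal.coe_strictMono.monotone.map_max).symm

protected theorem abs_nonneg (x : CInfty Q) : 0 ≤ |x| := by
  refine (le_def _ _).2 fun t => ?_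
  rw [zero_apply, EReal.coe_zero, abs_apply, le_max_iff, EReal.neg_nonneg]
  exact le_total 0 (x t)

theorem smul_apply (c : ℝ) {x : CInfty Q} {t : Q} {r : ℝ} (hx : x t = r) :
    (c • x) t = ((c * r : ℝ) : EReal) := by
  rw [Algebra.smul_def]
  exact mul_apply (ofC_apply (algebraMap ℝ C(Q, ℝ) c) t) hx

protected theorem abs_smul (c : ℝ) (x : CInfty Q) : |c • x| = |c| • |x| :=
  ext₁ x fun t r hr => by
    rw [abs_apply_coe (smul_apply c hr), smul_apply _ (abs_apply_coe hr), abs_mul]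

instance : PosSMulMono ℝ (CInfty Q) where
  smul_le_smul_of_nonneg_left c hc x y hxy := by
    refine le_of_dense (dense_inter x y) ?_
    rintro t ⟨⟨r, hr⟩, s, hs⟩
    have hrs : r ≤ s := EReal.coe_le_coe_iff.1 (hr ▸ hs ▸ hxy t)
    rw [smul_apply c hr, smul_apply c hs, EReal.coe_le_coe_iff]
    exact mul_le_mul_of_nonneg_left hrs hc

theorem smul_charFn_le {c : ℝ} {K : Clopens Q} {x : CInfty Q} (hx : 0 ≤ x)
    (h : ∀ t ∈ K, (c : EReal) ≤ x t) : c • charFn K ≤ x := by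
  refine (le_def _ _).2 fun t => ?_
  rw [smul_apply c (charFn_apply K t)]
  by_cases ht : t ∈ K
  · simpa [ht] using h t ht
  · simpa [ht, zero_apply] using (le_def 0 x).1 hx t

theorem exists_smul_charFn_le_abs {x : CInfty Q} (hx : x ≠ 0) :
    ∃ K : Clopens Q, K ≠ ⊥ ∧ ∃ c : ℝ, 0 < c ∧ c • charFn K ≤ |x| := by
  obtain ⟨t, r, hr, hr0⟩ := exists_coe_ne_zero hx
  have h_open : IsOpen {s | ((|r| / 2 : ℝ) : EReal) < |x| s} :=
    isOpen_lt continuous_const |x|.continuous_toFun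
  have h_mem : ((|r| / 2 : ℝ) : EReal) < |x| t := by
    rw [abs_apply_coe hr, EReal.coe_lt_coe_iff]
    exact half_lt_self (abs_pos.2 hr0)
  obtain ⟨K, hK, htK, hKx⟩ := compact_exists_isClopen_in_isOpen h_open h_mem
  have hK_ne : (⟨K, hK⟩ : Clopens Q) ≠ ⊥ := SetLike.coe_ne_coe.1 (Set.Nonempty.ne_empty ⟨t, htK⟩)
  exact ⟨⟨K, hK⟩, hK_ne, |r| / 2, half_pos (abs_pos.2 hr0),
    smul_charFn_le x.abs_nonneg fun s hs => (hKx hs).le⟩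

end CInfty

namespace StoneSpace

variable {B : Type u} [BooleanAlgebra B]

theorem basic_bot : basic (⊥ : B) = ∅ :=
  eq_empty_of_forall_notMem fun t ht => Bool.false_ne_true (t.eval_bot.symm.trans ht)

theorem basic_mono {a b : B} (h : a ≤ b) : basic a ⊆ basic b :=
  fun t => t.eval_mono h

theorem basic_sup (a b : B) : basic (a ⊔ b) = basic a ∪ basic b := by
  ext t
  simp [basic, eval_sup]

theorem exists_basic_eq_of_isClopen {K : Set (StoneSpace B)} (hK : IsClopen K) :
    ∃ e : B, basic e = K := by
  let U (e : {e : B // basic e ⊆ K}) : Set (StoneSpace B) := basic e.1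
  have h_cover : K ⊆ ⋃ e, U e := fun t ht =>
    have ⟨e, hte, heK⟩ := exists_basic_subset hK.isOpen ht
    mem_iUnion.2 ⟨⟨e, heK⟩, hte⟩
  have h_directed : Directed (· ⊆ ·) U := fun a b =>
    ⟨⟨a ⊔ b, basic_sup a.1 b.1 ▸ union_subset a.2 b.2⟩,
      basic_mono (le_sup_left : a.1 ≤ a.1 ⊔ b.1), basic_mono (le_sup_right : b.1 ≤ a.1 ⊔ b.1)⟩
  have : Nonempty {e : B // basic e ⊆ K} := ⟨⊥, basic_bot.trans_subset (empty_subset K)⟩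
  obtain ⟨e, he⟩ := hK.isClosed.isCompact.elim_directed_cover U
    (fun e => (isClopen_basic e.1).isOpen) h_cover h_directed
  exact ⟨e, e.2.antisymm he⟩

end StoneSpace

theorem L0.exists_idem_eq_charFn {B : Type u} [CompleteBooleanAlgebra B]
    {K : Clopens (StoneSpace B)} (hK : K ≠ ⊥) : ∃ q : B, q ≠ ⊥ ∧ L0.idem q = CInfty.charFn K := by
  obtain ⟨q, hq⟩ := StoneSpace.exists_basic_eq_of_isClopen K.isClopen
  refine ⟨q, ?_, ?_⟩
  · rintro rfl
    exact hK (SetLike.coe_injective (hq.symm.trans StoneSpace.basic_bot))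
  · refine congrArg CInfty.ofC (ContinuousMap.ext fun t => ?_)
    by_cases ht : t ∈ StoneSpace.basic q <;> simp [LocallyConstant.coe_charFn, ← hq, ht]

theorem mainTheorem10_general {Q : Type u} [TopologicalSpace Q] [CompactSpace Q] [T2Space Q]
    [ExtremallyDisconnected Q] (δ : Derivation ℝ C(Q, ℝ) (CInfty Q)) (hδ : δ ≠ 0) :
    ∃ (a : ℕ → C(Q, ℝ)) (K : Clopens Q), K ≠ ⊥ ∧
      ∀ n : ℕ, |a n| ≤ 1 ∧ (n : ℝ) • CInfty.charFn K ≤ |δ (a n)| := by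
  obtain ⟨x, hx⟩ : ∃ x, δ x ≠ 0 := DFunLike.ne_iff.1 hδ
  obtain ⟨K, hK, c, hc, hcK⟩ := CInfty.exists_smul_charFn_le_abs hx
  choose a ha hδa using fun n : ℕ => exists_norm_lt_map_eq_of_dense δ
    (dense_setOf_derivation_eq_zero δ) (((n : ℝ) / c) • x) one_pos
  refine ⟨a, K, hK, fun n => ⟨abs_le_one_of_norm_le_one (ha n).le, ?_⟩⟩
  have hnc : 0 ≤ (n : ℝ) / c := by positivity
  calc (n : ℝ) • CInfty.charFn K = ((n : ℝ) / c) • c • CInfty.charFn K := by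
        rw [smul_smul, div_mul_cancel₀ _ hc.ne']
    _ ≤ ((n : ℝ) / c) • |δ x| := smul_le_smul_of_nonneg_left hcK hnc
    _ = |((n : ℝ) / c) • δ x| := by rw [CInfty.abs_smul, abs_of_nonneg hnc]
    _ = |δ (((n : ℝ) / c) • x)| := by rw [δ.map_smul]
    _ = |δ (a n)| := congrArg _ (hδa n).symm

theorem mainTheorem10 {B : Type u} [CompleteBooleanAlgebra B]
    (δ : Derivation ℝ C(StoneSpace B, ℝ) (L0 B)) (hδ : δ ≠ 0) :
    ∃ (a : ℕ → C(StoneSpace B, ℝ)) (q : B), q ≠ ⊥ ∧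
      ∀ n : ℕ, |a n| ≤ 1 ∧ (n : ℝ) • L0.idem q ≤ |δ (a n)| := by
  obtain ⟨a, K, hK, ha⟩ := mainTheorem10_general δ hδ
  obtain ⟨q, hq, hqK⟩ := L0.exists_idem_eq_charFn hK
  exact ⟨a, q, hq, hqK ▸ ha⟩
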